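/- Let $p\ge 2$ and $\lambda>0$, and let $X$ be a random vector with values in the unit sphere $\mathcal S^{p-1}=\{x\in\mathbb R^p:\|x\|=1\}$ whose distribution is absolutely continuous with respect to the surface measure. Let $\Delta_{\mathcal S^{p-1}}$ denote the Laplace--Beltrami operator on $\mathcal S^{p-1}$, that is, $\Delta_{\mathcal S^{p-1}}f(x)=\Delta_y\big[f(y/\|y\|)\big]_{y=x}$ with the Euclidean Laplacian $\Delta_y$ of $\mathbb R^p$, and let $M_X(s)=\mathbb E[e^{s^\top X}]$, $s\in\mathbb R^p$, be the moment generating function of $X$. For $t\in\mathcal S^{p-1}$ let $\mathbb E[\Delta_{\mathcal S^{p-1}}e^{\lambda t^\top X}]$ denote the expectation of $\Delta_{\mathcal S^{p-1}}f_t(X)$, where $f_t(x)=e^{\lambda t^\top x}$. Then these expectations exist, $M_X$ is twice continuously differentiable, and $$\mathbb E\big[\Delta_{\mathcal S^{p-1}}e^{\lambda t^\top X}\big]=\Delta_{\mathcal S^{p-1}}M_X(\lambda t)\qquad\text{for every } t\in\mathcal S^{p-1},$$ where on the right-hand side the operator is applied to the function $t\mapsto M_X(\lambda t)$ on $\mathcal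 S^{p-1}$. Moreover, $$\mathbb E\big[\Delta_{\mathcal S^{p-1}}e^{\lambda t^\top X}\big]=0\ \text{ for every } t\in\mathcal S^{p-1}\quad\text{and}\quad M_X(0)=1$$ if and only if $X$ is uniformly distributed on $\mathcal S^{p-1}$, i.e. its distribution is the normalized surface measure. -/

import Mathlib

open MeasureTheory

/-- The unit sphere `S^{p-1} = {x ∈ ℝ^p : ‖x‖ = 1}`, with the Euclidean norm. -/
abbrev UnitSphere (p : ℕ) : Type :=
  Metric.sphere (0 : EuclideanSpace ℝ (Fin p)) 1

/-- The extension of a function `f` on the sphere to `ℝ^p ∖ {0}` that is constant along rays,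
`y ↦ f (y / ‖y‖)` (with the value `0` at the origin, which plays no role). -/
noncomputable def radialExtension {p : ℕ} (f : UnitSphere p → ℝ) :
    EuclideanSpace ℝ (Fin p) → ℝ := fun y =>
  open Classical in
  if h : y = 0 then 0
  else f ⟨‖y‖⁻¹ • y, by
    rw [mem_sphere_zero_iff_norm, norm_smul, norm_inv, norm_norm,
      inv_mul_cancel₀ (norm_ne_zero_iff.mpr h)]⟩

/-- The Laplace-Beltrami operator of the sphere, the spherical part of the Euclidean Laplacian:
`(Δ_S f)(x)` is the Euclidean Laplacian at `x` of `y ↦ f (y / ‖y‖)`. -/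
noncomputable def sphericalLaplacian {p : ℕ} (f : UnitSphere p → ℝ) (x : UnitSphere p) : ℝ :=
  Laplacian.laplacian (radialExtension f) (x : EuclideanSpace ℝ (Fin p))

/-- Surface measure on the sphere. -/
noncomputable def surfaceMeasure (p : ℕ) : Measure (UnitSphere p) :=
  (volume : Measure (EuclideanSpace ℝ (Fin p))).toSphere

/-- The uniform distribution: surface measure normalized to total mass one. -/
noncomputable def uniformSphere (p : ℕ) : Measure (UnitSphere p) :=
  (surfaceMeasure p Set.univ)⁻¹ • surfaceMeasure p

/-- The moment generating function `M_X(s) = E[exp(sᵀ X)]`, `s ∈ ℝ^p`. -/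
noncomputable def sphereMgf {Ω : Type*} [MeasurableSpace Ω] {p : ℕ}
    (P : Measure Ω) (X : Ω → UnitSphere p) (s : EuclideanSpace ℝ (Fin p)) : ℝ :=
  ∫ ω, Real.exp (inner ℝ s (X ω : EuclideanSpace ℝ (Fin p))) ∂P

/-- The exponential test function `x ↦ exp(lam tᵀ x)` on the sphere. -/
noncomputable def expTest {p : ℕ} (lam : ℝ) (t : UnitSphere p) : UnitSphere p → ℝ := fun x =>
  Real.exp (lam * inner ℝ (t : EuclideanSpace ℝ (Fin p)) (x : EuclideanSpace ℝ (Fin p)))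

/-! On unit vectors, `exp (lam ⟪t, x⟫)` is symmetric in `t` and `x`, so its spherical Laplacian is
the same in either variable, namely `K (lam • t, x)` with `K (s, x) = exp ⟪s, x⟫ * (‖s‖² - ⟪s, x⟫² -
(p - 1) ⟪s, x⟫)` (`sphericalKernel`). The first identity is then differentiation under the integral
over a compact sphere (`laplacian_integral_slice`).

For the uniform law, `M_X` is constant on spheres by rotation invariance, so its spherical Laplacian
vanishes. For the converse, let `W s` be the integral of `K (s, x)` against the law of `X`. The
angular Laplacian commutes with `Δ`, and `Δ exp ⟪s, x⟫ = exp ⟪s, x⟫` for unit `x`; hence `ΔW = W`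
(`laplacian_sphericalKernel`). As `W = 0` on the sphere of radius `lam`, the maximum principle gives
`W = 0` in the whole ball (`eq_zero_of_laplacian_eq_self`).

Along each ray, `W = 0` says that `m r = M_X (r • t)` solves `r² m - r² m'' - (p - 1) r m' = 0`, as
it does for the uniform law. The singular point `0` leaves only `m 0 = 1` to prescribe
(`eq_zero_of_radial_ode`), so the two generating functions agree near `0`; by analyticity the
characteristic functions agree, and so do the laws (`Measure.ext_of_mgf_inner_sphere`). -/

open Topology Set Filter ProbabilityTheory

/-! ### Differentiation under the integral sign over a compact space. -/

section ParametricIntegral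

variable {E F H K : Type*} [NormedAddCommGroup E] [NormedSpace ℝ E] [FiniteDimensional ℝ E]
  [NormedAddCommGroup F] [NormedSpace ℝ F]
  [NormedAddCommGroup H] [NormedSpace ℝ H]
  [TopologicalSpace K] [CompactSpace K] [SecondCountableTopology K]
  [MeasurableSpace K] [OpensMeasurableSpace K]

/-- Slices of a jointly continuous function over a compact space are integrable. -/
theorem integrable_slice_of_continuousOn {E F H : Type*} [NormedAddCommGroup E]
    [NormedAddCommGroup F] [NormedAddCommGroup H] (μ : Measure K) [IsFiniteMeasure μ] {U : Set E}
    {φ : K → H} (hφ : Continuous φ) {f : E × H → F} (hf : ContinuousOn f (U ×ˢ univ)) {s : E}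
    (hs : s ∈ U) : Integrable (fun x => f (s, φ x)) μ := by
  have hc : Continuous fun x : K => f (s, φ x) :=
    hf.comp_continuous (by fun_prop) fun x => ⟨hs, mem_univ _⟩
  obtain ⟨C, hC⟩ := isCompact_univ.exists_bound_of_continuousOn hc.continuousOn
  exact .of_bound hc.aestronglyMeasurable C (ae_of_all _ fun x => hC x (mem_univ x))

/-- Differentiation under the integral sign over a compact space. -/
theorem hasFDerivAt_integral_slice (μ : Measure K) [IsFiniteMeasure μ] {U : Set E}
    (hU : IsOpen U) {φ : K → H} (hφ : Continuous φ) {f : E × H → F}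
    (hf : ContDiffOn ℝ 1 f (U ×ˢ univ)) {s : E} (hs : s ∈ U) :
    HasFDerivAt (fun s => ∫ x, f (s, φ x) ∂μ)
      (∫ x, (fderiv ℝ f (s, φ x)).comp (.inl ℝ E H) ∂μ) s := by
  have hW : IsOpen (U ×ˢ (univ : Set H)) := hU.prod isOpen_univ
  have hf' : ContinuousOn (fun z => (fderiv ℝ f z).comp (.inl ℝ E H)) (U ×ˢ (univ : Set H)) :=
    (hf.continuousOn_fderiv_of_isOpen hW le_rfl).clm_comp continuousOn_const
  -- A closed ball is compact in finite dimension, so the derivative is bounded on ball × `K`; that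
  -- constant is the dominating function.
  obtain ⟨ε, hε, hεU⟩ := Metric.nhds_basis_closedBall.mem_iff.1 (hU.mem_nhds hs)
  have hc : ContinuousOn (fun z : E × K => (fderiv ℝ f (z.1, φ z.2)).comp (.inl ℝ E H))
      (Metric.closedBall s ε ×ˢ univ) :=
    hf'.comp (by fun_prop) fun z hz => ⟨hεU hz.1, mem_univ _⟩
  obtain ⟨C, hC⟩ := ((isCompact_closedBall s ε).prod isCompact_univ).exists_bound_of_continuousOn hc
  refine hasFDerivAt_integral_of_dominated_of_fderiv_le (bound := fun _ => C)
    (Metric.closedBall_mem_nhds s hε) ?_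
    (integrable_slice_of_continuousOn μ hφ hf.continuousOn hs)
    (integrable_slice_of_continuousOn μ hφ hf' hs).1
    (ae_of_all _ fun x y hy => hC (y, x) ⟨hy, mem_univ _⟩) (integrable_const C)
    (ae_of_all _ fun x y hy => ?_)
  · filter_upwards [hU.mem_nhds hs] with y hy
    exact (integrable_slice_of_continuousOn μ hφ hf.continuousOn hy).1
  · have h1 : HasFDerivAt f (fderiv ℝ f (y, φ x)) (y, φ x) :=
      ((hf.contDiffAt (hW.mem_nhds ⟨hεU hy, mem_univ _⟩)).differentiableAt one_ne_zero).hasFDerivAt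
    exact h1.comp y (hasFDerivAt_prodMk_left y (φ x))

/-- Induction over all targets `F` at once: the derivative is an integral of the same form, with
values in `E →L[ℝ] F`. -/
theorem contDiffOn_integral_slice {E H : Type} [NormedAddCommGroup E] [NormedSpace ℝ E]
    [FiniteDimensional ℝ E] [NormedAddCommGroup H] [NormedSpace ℝ H]
    (μ : Measure K) [IsFiniteMeasure μ] {U : Set E}
    (hU : IsOpen U) {φ : K → H} (hφ : Continuous φ) (n : ℕ) {F : Type} [NormedAddCommGroup F]
    [NormedSpace ℝ F] {f : E × H → F} (hf : ContDiffOn ℝ n f (U ×ˢ univ)) :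
    ContDiffOn ℝ n (fun s => ∫ x, f (s, φ x) ∂μ) U := by
  have hW : IsOpen (U ×ˢ (univ : Set H)) := hU.prod isOpen_univ
  induction n generalizing F with
  | zero =>
    rw [Nat.cast_zero, contDiffOn_zero] at hf ⊢
    intro s hs
    obtain ⟨ε, hε, hεU⟩ := Metric.nhds_basis_closedBall.mem_iff.1 (hU.mem_nhds hs)
    have hc : ContinuousOn (fun z : E × K => f (z.1, φ z.2)) (Metric.closedBall s ε ×ˢ univ) :=
      hf.comp (by fun_prop) fun z hz => ⟨hεU hz.1, mem_univ _⟩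
    obtain ⟨C, hC⟩ :=
      ((isCompact_closedBall s ε).prod isCompact_univ).exists_bound_of_continuousOn hc
    refine (continuousAt_of_dominated (bound := fun _ => C) ?_ ?_ (integrable_const C)
      (ae_of_all _ fun x => ?_)).continuousWithinAt
    · filter_upwards [hU.mem_nhds hs] with y hy
      exact (integrable_slice_of_continuousOn μ hφ hf hy).1
    · filter_upwards [Metric.closedBall_mem_nhds s hε] with y hy
      exact ae_of_all _ fun x => hC (y, x) ⟨hy, mem_univ _⟩
    · exact ContinuousAt.comp (f := fun y => (y, φ x))
        (hf.continuousAt (hW.mem_nhds ⟨hs, mem_univ _⟩)) (by fun_prop)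
  | succ n ih =>
    have h1 : ContDiffOn ℝ 1 f (U ×ˢ univ) := hf.of_le (by norm_cast; omega)
    push_cast at hf ⊢
    rw [contDiffOn_succ_iff_fderiv_of_isOpen hU]
    refine ⟨fun s hs => (hasFDerivAt_integral_slice μ hU hφ h1 hs).differentiableAt
      |>.differentiableWithinAt, by simp, ?_⟩
    have h2 : ContDiffOn ℝ n (fun z => (fderiv ℝ f z).comp (.inl ℝ E H)) (U ×ˢ (univ : Set H)) :=
      (hf.fderiv_of_isOpen hW le_rfl).clm_comp contDiffOn_const
    exact (ih h2).congr fun s hs => (hasFDerivAt_integral_slice μ hU hφ h1 hs).fderiv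

end ParametricIntegral

/-! ### The Laplacian in an orthonormal basis and under the integral. -/

section Laplacian

variable {E H K : Type} [NormedAddCommGroup E] [InnerProductSpace ℝ E] [FiniteDimensional ℝ E]
  [NormedAddCommGroup H] [NormedSpace ℝ H]
  [TopologicalSpace K] [CompactSpace K] [SecondCountableTopology K]
  [MeasurableSpace K] [OpensMeasurableSpace K]

theorem fderiv_fderiv_apply {E F : Type*} [NormedAddCommGroup E] [NormedSpace ℝ E]
    [NormedAddCommGroup F] [NormedSpace ℝ F] {f : E → F} {x : E} (hf : ContDiffAt ℝ 2 f x)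
    (v w : E) : fderiv ℝ (fun y => fderiv ℝ f y v) x w = fderiv ℝ (fderiv ℝ f) x w v := by
  have h : DifferentiableAt ℝ (fderiv ℝ f) x :=
    (hf.fderiv_right (m := 1) (by norm_num)).differentiableAt one_ne_zero
  rw [fderiv_clm_apply h (differentiableAt_const v)]
  simp

theorem laplacian_eq_sum_fderiv {ι : Type*} [Fintype ι] (b : OrthonormalBasis ι ℝ E) {f : E → ℝ}
    {x : E} (hf : ContDiffAt ℝ 2 f x) :
    Laplacian.laplacian f x = ∑ i, fderiv ℝ (fun y => fderiv ℝ f y (b i)) x (b i) := by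
  rw [InnerProductSpace.laplacian_eq_iteratedFDeriv_orthonormalBasis f b]
  refine Finset.sum_congr rfl fun i _ => ?_
  rw [fderiv_fderiv_apply hf, iteratedFDeriv_two_apply]
  rfl

/-- The Laplacian as the sum of the second derivatives along lines. -/
theorem laplacian_eq_sum_of_hasDerivAt {ι : Type*} [Fintype ι] (b : OrthonormalBasis ι ℝ E)
    {f : E → ℝ} {x : E} (hf : ContDiffAt ℝ 2 f x) (f' : ι → ℝ → ℝ) (f'' : ι → ℝ)
    (h1 : ∀ i, ∀ᶠ r in 𝓝 (0 : ℝ), HasDerivAt (fun r => f (x + r • b i)) (f' i r) r)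
    (h2 : ∀ i, HasDerivAt (f' i) (f'' i) 0) :
    Laplacian.laplacian f x = ∑ i, f'' i := by
  rw [laplacian_eq_sum_fderiv b hf]
  refine Finset.sum_congr rfl fun i _ => ?_
  have hline (r : ℝ) : HasDerivAt (fun r : ℝ => x + r • b i) (b i) r := by
    simpa using ((hasDerivAt_id r).smul_const (b i)).const_add x
  have hlim : Tendsto (fun r : ℝ => x + r • b i) (𝓝 0) (𝓝 x) := by
    simpa using (hline 0).continuousAt.tendsto
  have hev : ∀ᶠ r in 𝓝 (0 : ℝ), f' i r = fderiv ℝ f (x + r • b i) (b i) := by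
    have h3 := hlim.eventually (hf.eventually (by simp))
    filter_upwards [h1 i, h3] with r hr hr3
    exact hr.unique ((hr3.differentiableAt two_ne_zero).hasFDerivAt.comp_hasDerivAt r (hline r))
  have hd : DifferentiableAt ℝ (fun y => fderiv ℝ f y (b i)) x :=
    ((hf.fderiv_right (m := 1) (by norm_num)).differentiableAt one_ne_zero).clm_apply
      (differentiableAt_const _)
  have hx : x = x + (0 : ℝ) • b i := by simp
  have h4 : HasDerivAt (fun r : ℝ => fderiv ℝ f (x + r • b i) (b i))
      (fderiv ℝ (fun y => fderiv ℝ f y (b i)) x (b i)) 0 := by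
    rw [hx] at hd
    have := hd.hasFDerivAt.comp_hasDerivAt 0 (hline 0)
    rwa [← hx] at this
  exact (h4.congr_of_eventuallyEq hev).unique (h2 i)

/-- The Laplacian commutes with integration of a parameter over a compact space. -/
theorem laplacian_integral_slice (μ : Measure K) [IsFiniteMeasure μ] {U : Set E}
    (hU : IsOpen U) {φ : K → H} (hφ : Continuous φ) {f : E × H → ℝ}
    (hf : ContDiffOn ℝ 2 f (U ×ˢ univ)) {s : E} (hs : s ∈ U) :
    Laplacian.laplacian (fun s => ∫ x, f (s, φ x) ∂μ) s =
      ∫ x, Laplacian.laplacian (fun y => f (y, φ x)) s ∂μ := by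
  have hW : IsOpen (U ×ˢ (univ : Set H)) := hU.prod isOpen_univ
  have key {g : E × H → ℝ} (hg : ContDiffOn ℝ 1 g (U ×ˢ univ)) (v : E) {y : E} (hy : y ∈ U) :
      fderiv ℝ (fun s => ∫ x, g (s, φ x) ∂μ) y v = ∫ x, fderiv ℝ g (y, φ x) (v, 0) ∂μ := by
    rw [(hasFDerivAt_integral_slice μ hU hφ hg hy).fderiv, ContinuousLinearMap.integral_apply]
    · simp
    · exact integrable_slice_of_continuousOn μ hφ (f := fun z => (fderiv ℝ g z).comp (.inl ℝ E H))
        ((hg.continuousOn_fderiv_of_isOpen hW le_rfl).clm_comp continuousOn_const) hy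
  -- Partial derivatives are written as full derivatives along `(v, 0)`, which are again jointly
  -- `C^1`, so `key` can be applied a second time.
  have slice {g : E × H → ℝ} (hg : ContDiffOn ℝ 1 g (U ×ˢ univ)) (v : E) {y : E} (hy : y ∈ U)
      (h : H) : fderiv ℝ (fun s => g (s, h)) y v = fderiv ℝ g (y, h) (v, 0) := by
    have h1 : HasFDerivAt g (fderiv ℝ g (y, h)) (y, h) :=
      ((hg.contDiffAt (hW.mem_nhds ⟨hy, mem_univ _⟩)).differentiableAt one_ne_zero).hasFDerivAt
    have h2 : HasFDerivAt (fun s => g (s, h)) ((fderiv ℝ g (y, h)).comp (.inl ℝ E H)) y :=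
      h1.comp y (hasFDerivAt_prodMk_left y h)
    simp [h2.fderiv]
  have hf1 : ContDiffOn ℝ 1 f (U ×ˢ univ) := hf.of_le (by norm_num)
  have hD (v : E) : ContDiffOn ℝ 1 (fun z => fderiv ℝ f z (v, (0 : H))) (U ×ˢ univ) :=
    (hf.fderiv_of_isOpen hW (by norm_num)).clm_apply contDiffOn_const
  have hDD (v : E) : ContinuousOn
      (fun z => fderiv ℝ (fun z => fderiv ℝ f z (v, (0 : H))) z (v, 0)) (U ×ˢ univ) :=
    ((hD v).continuousOn_fderiv_of_isOpen hW le_rfl).clm_apply continuousOn_const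
  have hG : ContDiffAt ℝ 2 (fun s => ∫ x, f (s, φ x) ∂μ) s :=
    (contDiffOn_integral_slice μ hU hφ 2 (by exact_mod_cast hf)).contDiffAt (hU.mem_nhds hs)
  let b := stdOrthonormalBasis ℝ E
  rw [laplacian_eq_sum_fderiv b hG]
  have hx (x : K) : Laplacian.laplacian (fun y => f (y, φ x)) s =
      ∑ i, fderiv ℝ (fun z => fderiv ℝ f z (b i, (0 : H))) (s, φ x) (b i, 0) := by
    have hfx : ContDiffAt ℝ 2 (fun y => f (y, φ x)) s :=
      ContDiffAt.comp s (g := f) (f := fun y => (y, φ x))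
        (hf.contDiffAt (hW.mem_nhds ⟨hs, mem_univ _⟩)) (contDiffAt_id.prodMk contDiffAt_const)
    rw [laplacian_eq_sum_fderiv b hfx]
    refine Finset.sum_congr rfl fun i _ => ?_
    rw [← slice (hD (b i)) (b i) hs]
    congr 1
    refine Filter.EventuallyEq.fderiv_eq ?_
    filter_upwards [hU.mem_nhds hs] with y hy
    exact slice hf1 _ hy _
  simp_rw [hx]
  rw [integral_finsetSum _ fun i _ => integrable_slice_of_continuousOn μ hφ (hDD (b i)) hs]
  refine Finset.sum_congr rfl fun i _ => ?_
  rw [← key (hD (b i)) (b i) hs]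
  congr 1
  refine Filter.EventuallyEq.fderiv_eq ?_
  filter_upwards [hU.mem_nhds hs] with y hy
  exact key hf1 _ hy

end Laplacian

/-! ### Explicit Laplacians of exponentials and of the kernel. -/

section Formulas

variable {E : Type} [NormedAddCommGroup E] [InnerProductSpace ℝ E]

theorem OrthonormalBasis.sum_inner_mul_inner_right {ι : Type*} [Fintype ι]
    (b : OrthonormalBasis ι ℝ E) (x y : E) :
    ∑ i, inner ℝ x (b i) * inner ℝ y (b i) = inner ℝ x y := by
  rw [← b.sum_inner_mul_inner x y]
  exact Finset.sum_congr rfl fun i _ => by rw [real_inner_comm y]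

theorem contDiffAt_exp_inner_normalize {n : WithTop ℕ∞} (c : ℝ) {z : E × E} (hz : z.1 ≠ 0) :
    ContDiffAt ℝ n (fun z : E × E => Real.exp (c * inner ℝ (‖z.1‖⁻¹ • z.1) z.2)) z :=
  (contDiffAt_const.mul (((contDiffAt_fst.norm ℝ hz).inv (norm_ne_zero_iff.2 hz)).smul
    contDiffAt_fst |>.inner ℝ contDiffAt_snd)).exp

variable [FiniteDimensional ℝ E] in
/-- The spherical Laplacian of the exponential of a linear form. -/
theorem laplacian_exp_inner_normalize (c : ℝ) {x : E} (hx : ‖x‖ = 1) {t : E} (ht : ‖t‖ = 1) :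
    Laplacian.laplacian (fun y : E => Real.exp (c * inner ℝ (‖y‖⁻¹ • y) t)) x =
      Real.exp (c * inner ℝ x t) * (c ^ 2 * (1 - inner ℝ x t ^ 2)
        - (Module.finrank ℝ E - 1) * (c * inner ℝ x t)) := by
  have hx0 : x ≠ 0 := by rintro rfl; simp at hx
  have hC : ContDiffAt ℝ 2 (fun y : E => Real.exp (c * inner ℝ (‖y‖⁻¹ • y) t)) x :=
    ContDiffAt.comp x (g := fun z : E × E => Real.exp (c * inner ℝ (‖z.1‖⁻¹ • z.1) z.2))
      (f := fun y => (y, t)) (contDiffAt_exp_inner_normalize c hx0)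
      (contDiffAt_id.prodMk contDiffAt_const)
  let b := stdOrthonormalBasis ℝ E
  set u := inner ℝ x t with hu
  let β : Fin (Module.finrank ℝ E) → ℝ := fun i => inner ℝ x (b i)
  let a : Fin (Module.finrank ℝ E) → ℝ := fun i => inner ℝ t (b i)
  -- Along the line `x + r • b i`, `ρ` is the norm; below, `φ` is the inner product of the
  -- normalized point with `t`, and `ψ` is the derivative of `φ`.
  let ρ : Fin (Module.finrank ℝ E) → ℝ → ℝ := fun i r => Real.sqrt (1 + 2 * r * β i + r ^ 2)
  have hnorm (i) (r : ℝ) : ‖x + r • b i‖ = ρ i r := by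
    rw [← Real.sqrt_sq (norm_nonneg (x + r • b i)), norm_add_sq_real, hx, norm_smul, b.norm_eq_one,
      real_inner_smul_right]
    congr 1
    simp [β]; ring
  have hin (i) (r : ℝ) : inner ℝ (‖x + r • b i‖⁻¹ • (x + r • b i)) t
      = (u + r * a i) / ρ i r := by
    rw [hnorm, real_inner_smul_left, inner_add_left, real_inner_smul_left, real_inner_comm t (b i)]
    simp only [a, hu]; field_simp
  have hρ0 (i) : ρ i 0 = 1 := by simp [ρ]
  have hρpos (i) : ∀ᶠ r in 𝓝 (0 : ℝ), 0 < 1 + 2 * r * β i + r ^ 2 :=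
    ContinuousAt.eventually_lt (by fun_prop) (by fun_prop) (by simp)
  have hρ' (i) (r : ℝ) (hr : 0 < 1 + 2 * r * β i + r ^ 2) :
      HasDerivAt (ρ i) ((β i + r) / ρ i r) r := by
    have h : HasDerivAt (fun r : ℝ => 1 + 2 * r * β i + r ^ 2) (2 * β i + 2 * r) r := by
      have h1 := (((hasDerivAt_id r).const_mul 2).mul_const (β i)).const_add 1
      have h2 := h1.add (hasDerivAt_pow 2 r)
      convert! h2 using 1
      simp
    convert! h.sqrt hr.ne' using 1
    simp only [ρ]; field_simp
  have hnum (i) (r : ℝ) : HasDerivAt (fun r : ℝ => u + r * a i) (a i) r := by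
    simpa using ((hasDerivAt_id r).mul_const (a i)).const_add u
  let φ : Fin (Module.finrank ℝ E) → ℝ → ℝ := fun i r => (u + r * a i) / ρ i r
  let ψ : Fin (Module.finrank ℝ E) → ℝ → ℝ := fun i r =>
    a i / ρ i r - (u + r * a i) * (β i + r) / ρ i r ^ 3
  have hφ (i) (r : ℝ) (hr : 0 < 1 + 2 * r * β i + r ^ 2) : HasDerivAt (φ i) (ψ i r) r := by
    have hr0 : ρ i r ≠ 0 := (Real.sqrt_pos.2 hr).ne'
    convert! (hnum i r).div (hρ' i r hr) hr0 using 1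
    simp only [ψ]; field_simp
  have hψ (i) : HasDerivAt (ψ i) (-2 * a i * β i - u + 3 * u * β i ^ 2) 0 := by
    have h0 := hρ' i 0 (by simp)
    have hr0 : ρ i 0 ≠ 0 := by simp [hρ0]
    have h1 := (hasDerivAt_const (0 : ℝ) (a i)).div h0 hr0
    have h2 := ((hnum i 0).mul ((hasDerivAt_id (0 : ℝ)).const_add (β i))).div (h0.pow 3)
      (pow_ne_zero 3 hr0)
    convert! h1.sub h2 using 1
    simp [hρ0]; ring
  rw [laplacian_eq_sum_of_hasDerivAt b hC
    (fun i r => Real.exp (c * φ i r) * (c * ψ i r))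
    (fun i => Real.exp (c * u) * (c ^ 2 * (a i - u * β i) ^ 2
      + c * (-2 * a i * β i - u + 3 * u * β i ^ 2)))
    (fun i => ?_) (fun i => ?_)]
  · rw [← Finset.mul_sum]
    congr 1
    have e1 : ∑ i, β i * β i = 1 := by
      rw [b.sum_inner_mul_inner_right, real_inner_self_eq_norm_sq, hx, one_pow]
    have e2 : ∑ i, a i * a i = 1 := by
      rw [b.sum_inner_mul_inner_right, real_inner_self_eq_norm_sq, ht, one_pow]
    have e3 : ∑ i, β i * a i = u := b.sum_inner_mul_inner_right x t
    have e4 : ∑ _i : Fin (Module.finrank ℝ E), (1 : ℝ) = Module.finrank ℝ E := by simp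
    calc _ = ∑ i, (c ^ 2 * (a i * a i) + (-2 * c ^ 2 * u - 2 * c) * (β i * a i)
          + (c ^ 2 * u ^ 2 + 3 * c * u) * (β i * β i) + -(c * u) * 1) :=
          Finset.sum_congr rfl fun i _ => by ring
      _ = _ := by
          simp only [Finset.sum_add_distrib, ← Finset.mul_sum, e1, e2, e3, e4]
          ring
  · filter_upwards [hρpos i] with r hr
    simp_rw [hin]
    exact ((hφ i r hr).const_mul c).exp
  · have hφ0 : φ i 0 = u := by simp [φ, hρ0]
    have hψ0 : ψ i 0 = a i - u * β i := by simp [ψ, hρ0]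
    convert! ((hφ i 0 (by simp)).const_mul c).exp.mul ((hψ i).const_mul c) using 1
    rw [hφ0, hψ0]; ring

/-- For `‖x‖ = 1` and `s = r • t` with `‖t‖ = 1`, `sphericalKernel c (s, x)` is the value at `t` of
the Laplace-Beltrami operator applied to `t ↦ exp ⟪r • t, x⟫`, in dimension `c + 1`. -/
noncomputable def sphericalKernel (c : ℝ) (z : E × E) : ℝ :=
  Real.exp (inner ℝ z.1 z.2) * (‖z.1‖ ^ 2 - inner ℝ z.1 z.2 ^ 2 - c * inner ℝ z.1 z.2)

theorem contDiff_sphericalKernel {n : WithTop ℕ∞} (c : ℝ) :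
    ContDiff ℝ n (sphericalKernel (E := E) c) := by
  have h : ContDiff ℝ n fun z : E × E => inner ℝ z.1 z.2 := contDiff_fst.inner ℝ contDiff_snd
  exact h.exp.mul (((contDiff_fst.norm_sq ℝ).sub (h.pow 2)).sub (contDiff_const.mul h))

variable [FiniteDimensional ℝ E] in
-- Conceptually, the kernel is the angular part of `‖s‖² Δ` applied to `exp ⟪s, x⟫`, and this
-- operator commutes with `Δ`. The proof verifies the identity by direct computation.
theorem laplacian_sphericalKernel (s : E) {x : E} (hx : ‖x‖ = 1) :
    Laplacian.laplacian
      (fun y : E => sphericalKernel (Module.finrank ℝ E - 1 : ℝ) (y, x)) s =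
      sphericalKernel (Module.finrank ℝ E - 1 : ℝ) (s, x) := by
  set k : ℝ := Module.finrank ℝ E - 1 with hk
  have hC : ContDiffAt ℝ 2 (fun y : E => sphericalKernel k (y, x)) s :=
    ((contDiff_sphericalKernel k).comp (contDiff_id.prodMk contDiff_const)).contDiffAt
  let b := stdOrthonormalBasis ℝ E
  set c := inner ℝ s x with hc
  set S := ‖s‖ ^ 2 with hS
  let a : Fin (Module.finrank ℝ E) → ℝ := fun i => inner ℝ x (b i)
  let d : Fin (Module.finrank ℝ E) → ℝ := fun i => inner ℝ s (b i)
  let q : Fin (Module.finrank ℝ E) → ℝ → ℝ := fun i r =>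
    (S + 2 * r * d i + r ^ 2) - (c + r * a i) ^ 2 - k * (c + r * a i)
  let q' : Fin (Module.finrank ℝ E) → ℝ → ℝ := fun i r =>
    2 * d i + 2 * r - 2 * (c + r * a i) * a i - k * a i
  have hnum (i) (r : ℝ) : HasDerivAt (fun r : ℝ => c + r * a i) (a i) r := by
    simpa using ((hasDerivAt_id r).mul_const (a i)).const_add c
  have hq (i) (r : ℝ) : HasDerivAt (q i) (q' i r) r := by
    have h1 := (((hasDerivAt_id r).const_mul 2).mul_const (d i)).const_add S
    convert! ((h1.add (hasDerivAt_pow 2 r)).sub ((hnum i r).pow 2)).sub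
      ((hnum i r).const_mul k) using 1
    simp [q']
  have hq' (i) : HasDerivAt (q' i) (2 - 2 * a i ^ 2) 0 := by
    have h1 := ((hasDerivAt_id (0 : ℝ)).const_mul 2).const_add (2 * d i)
    convert! (h1.sub (((hnum i 0).const_mul 2).mul_const (a i))).sub_const (k * a i) using 1
    ring
  have hker (i) (r : ℝ) :
      sphericalKernel k (s + r • b i, x) = Real.exp (c + r * a i) * q i r := by
    have h1 : ‖s + r • b i‖ ^ 2 = S + 2 * r * d i + r ^ 2 := by
      rw [norm_add_sq_real, norm_smul, b.norm_eq_one, real_inner_smul_right]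
      simp [d, hS]; ring
    have h2 : inner ℝ (s + r • b i) x = c + r * a i := by
      rw [inner_add_left, real_inner_smul_left, real_inner_comm x (b i)]
    simp only [sphericalKernel, h1, h2, q]
  rw [laplacian_eq_sum_of_hasDerivAt b hC
    (fun i r => Real.exp (c + r * a i) * a i * q i r + Real.exp (c + r * a i) * q' i r)
    (fun i => Real.exp c * (a i ^ 2 * (S - c ^ 2 - k * c)
      + 2 * a i * (2 * d i - 2 * c * a i - k * a i) + (2 - 2 * a i ^ 2)))
    (fun i => ?_) (fun i => ?_)]
  · rw [← Finset.mul_sum]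
    change _ = Real.exp c * (S - c ^ 2 - k * c)
    congr 1
    have e1 : ∑ i, a i * a i = 1 := by
      rw [b.sum_inner_mul_inner_right, real_inner_self_eq_norm_sq, hx, one_pow]
    have e3 : ∑ i, d i * a i = c := b.sum_inner_mul_inner_right s x
    -- The choice of `k` as dimension minus one matters here: the term `2 * 1` sums to `2 * (k + 1)`
    -- and cancels `-2 * k - 2`.
    have e4 : ∑ _i : Fin (Module.finrank ℝ E), (1 : ℝ) = k + 1 := by simp [hk]
    calc _ = ∑ i, (((S - c ^ 2 - k * c) - 4 * c - 2 * k - 2) * (a i * a i) + 4 * (d i * a i)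
          + 2 * 1) := Finset.sum_congr rfl fun i _ => by ring
      _ = _ := by
          simp only [Finset.sum_add_distrib, ← Finset.mul_sum, e1, e3, e4]
          ring
  · refine .of_forall fun r => ?_
    simp_rw [hker]
    exact (hnum i r).exp.mul (hq i r)
  · have he := (hnum i 0).exp
    convert! ((he.mul_const (a i)).mul (hq i 0)).add (he.mul (hq' i)) using 1
    simp [q, q']; ring

end Formulas

/-- The second derivative test, as a necessary condition. -/
theorem IsLocalMax.deriv_deriv_nonpos {f : ℝ → ℝ} {a : ℝ} (h : IsLocalMax f a)
    (hf : ContinuousAt f a) : deriv (deriv f) a ≤ 0 := by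
  by_contra! hpos
  have hmin : IsLocalMin f a := isLocalMin_of_deriv_deriv_pos hpos h.deriv_eq_zero hf
  have hconst : f =ᶠ[𝓝 a] fun _ => f a := by
    filter_upwards [h, hmin] with x h1 h2 using le_antisymm h1 h2
  have : deriv (deriv f) a = 0 := by
    rw [hconst.deriv.deriv_eq]
    simp
  exact hpos.ne' this

/-! ### Maximum principle for `ΔW = W`. -/

section MaximumPrinciple

variable {E : Type} [NormedAddCommGroup E] [InnerProductSpace ℝ E] [FiniteDimensional ℝ E]

theorem IsLocalMax.laplacian_nonpos {f : E → ℝ} {x : E} (h : IsLocalMax f x)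
    (hf : ContDiffAt ℝ 2 f x) : Laplacian.laplacian f x ≤ 0 := by
  let b := stdOrthonormalBasis ℝ E
  have hline (i) (r : ℝ) : HasDerivAt (fun r : ℝ => x + r • b i) (b i) r := by
    simpa using ((hasDerivAt_id r).smul_const (b i)).const_add x
  have hlim (i) : Tendsto (fun r : ℝ => x + r • b i) (𝓝 0) (𝓝 x) := by
    simpa using (hline i 0).continuousAt.tendsto
  have hx (i) : x + (0 : ℝ) • b i = x := by simp
  have hev (i) : ∀ᶠ r in 𝓝 (0 : ℝ), HasDerivAt (fun r : ℝ => f (x + r • b i))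
      (fderiv ℝ f (x + r • b i) (b i)) r := by
    filter_upwards [(hlim i).eventually (hf.eventually (by simp))] with r hr
    exact (hr.differentiableAt two_ne_zero).hasFDerivAt.comp_hasDerivAt r (hline i r)
  have hd (i) : HasDerivAt (fun r : ℝ => fderiv ℝ f (x + r • b i) (b i))
      (fderiv ℝ (fun y => fderiv ℝ f y (b i)) x (b i)) 0 := by
    have hd : DifferentiableAt ℝ (fun y => fderiv ℝ f y (b i)) (x + (0 : ℝ) • b i) := by
      rw [hx]
      exact ((hf.fderiv_right (m := 1) (by norm_num)).differentiableAt one_ne_zero).clm_apply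
        (differentiableAt_const _)
    have := hd.hasFDerivAt.comp_hasDerivAt 0 (hline i 0)
    rwa [hx] at this
  rw [laplacian_eq_sum_fderiv b hf]
  refine Finset.sum_nonpos fun i _ => ?_
  rw [← ((hd i).congr_of_eventuallyEq ((hev i).mono fun r hr => hr.deriv)).deriv]
  refine IsLocalMax.deriv_deriv_nonpos ?_ (hev i).self_of_nhds.continuousAt
  have := (hlim i).eventually h
  filter_upwards [this] with r hr
  simpa using hr

/-- At an interior maximum `W = ΔW ≤ 0`, and on the boundary `W = 0`, so the maximum over the closed
ball is nonpositive. -/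
theorem nonpos_of_laplacian_eq_self {W : E → ℝ} {R : ℝ} (hW : ContDiff ℝ 2 W)
    (hΔ : ∀ s ∈ Metric.ball (0 : E) R, Laplacian.laplacian W s = W s)
    (hR : ∀ s, ‖s‖ = R → W s = 0) {s : E} (hs : ‖s‖ ≤ R) : W s ≤ 0 := by
  obtain ⟨m, hm, hmax⟩ := (isCompact_closedBall (0 : E) R).exists_isMaxOn
    ⟨s, by simpa using hs⟩ hW.continuous.continuousOn
  refine (hmax (show s ∈ _ by simpa using hs)).trans ?_
  rw [mem_closedBall_zero_iff] at hm
  rcases hm.eq_or_lt with h | h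
  · exact (hR m h).le
  · have hb : m ∈ Metric.ball (0 : E) R := by simpa using h
    rw [← hΔ m hb]
    refine IsLocalMax.laplacian_nonpos ?_ hW.contDiffAt
    filter_upwards [Metric.isOpen_ball.mem_nhds hb] with y hy
    exact hmax (Metric.ball_subset_closedBall hy)

/-- Uniqueness for the Dirichlet problem `ΔW = W` on a ball. -/
theorem eq_zero_of_laplacian_eq_self {W : E → ℝ} {R : ℝ} (hW : ContDiff ℝ 2 W)
    (hΔ : ∀ s ∈ Metric.ball (0 : E) R, Laplacian.laplacian W s = W s)
    (hR : ∀ s, ‖s‖ = R → W s = 0) {s : E} (hs : ‖s‖ ≤ R) : W s = 0 := by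
  refine le_antisymm (nonpos_of_laplacian_eq_self hW hΔ hR hs) (neg_nonpos.1 ?_)
  refine nonpos_of_laplacian_eq_self (W := -W) hW.neg (fun y hy => ?_) (fun y hy => ?_) hs
  · rw [InnerProductSpace.laplacian_neg]
    simp [hΔ y hy]
  · simp [hR y hy]

end MaximumPrinciple

/-! ### Uniqueness for the radial equation at its singular point. -/

section RadialODE

/-- A solution of `r g'' + k g' = r g`, `k > 0`, that vanishes at the singular point `0` vanishes
identically. -/
theorem eq_zero_of_radial_ode {g g₁ g₂ : ℝ → ℝ} {k R : ℝ} (hk : 0 < k)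
    (h₀ : ∀ r, HasDerivAt g (g₁ r) r) (h₁ : ∀ r, HasDerivAt g₁ (g₂ r) r) (hc : Continuous g₂)
    (hode : ∀ r ∈ Ioo 0 R, r ^ 2 * g r - r ^ 2 * g₂ r - k * r * g₁ r = 0) (hg : g 0 = 0)
    {r : ℝ} (hr : r ∈ Icc 0 R) : g r = 0 := by
  rcases (hr.1.trans hr.2).eq_or_lt with hR | hR
  · rw [le_antisymm (hR ▸ hr.2) hr.1, hg]
  have hcg : Continuous g := continuous_iff_continuousAt.2 fun r => (h₀ r).continuousAt
  have hcg₁ : Continuous g₁ := continuous_iff_continuousAt.2 fun r => (h₁ r).continuousAt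
  have hode' : ∀ r ∈ Ioo 0 R, r * g r - r * g₂ r - k * g₁ r = 0 := fun r hr => by
    have h := hode r hr
    have : r * (r * g r - r * g₂ r - k * g₁ r) = 0 := by linear_combination h
    exact (mul_eq_zero.1 this).resolve_left hr.1.ne'
  -- Letting `r → 0⁺` in the equation divided by `r` leaves `k * g₁ 0 = 0`.
  have hg₁ : g₁ 0 = 0 := by
    have hcont : Continuous fun r => r * g r - r * g₂ r - k * g₁ r := by fun_prop
    have hlim : Tendsto (fun r => r * g r - r * g₂ r - k * g₁ r) (𝓝[>] 0) (𝓝 0) := by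
      refine tendsto_const_nhds.congr' ?_
      filter_upwards [Ioo_mem_nhdsGT hR] with r hr using (hode' r hr).symm
    have := tendsto_nhds_unique (hcont.continuousAt.tendsto.mono_left nhdsWithin_le_nhds) hlim
    simpa [hk.ne'] using this
  -- Energy argument: by the equation, `(g₁² - g²)' = -2 k g₁² / r ≤ 0`. The energy is `0` at `0`,
  -- so `|g₁| ≤ |g|`, and Grönwall's inequality forces `g = 0`.
  have hE (r : ℝ) : HasDerivAt (fun r => g₁ r ^ 2 - g r ^ 2)
      (2 * g₁ r * g₂ r - 2 * g r * g₁ r) r := by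
    convert! ((h₁ r).pow 2).sub ((h₀ r).pow 2) using 1
    simp
  have hanti : AntitoneOn (fun r => g₁ r ^ 2 - g r ^ 2) (Icc 0 R) := by
    refine antitoneOn_of_deriv_nonpos (convex_Icc 0 R) (by fun_prop)
      (fun r _ => (hE r).differentiableAt.differentiableWithinAt) fun r hr => ?_
    rw [interior_Icc] at hr
    rw [(hE r).deriv]
    have h : r * (2 * g₁ r * g₂ r - 2 * g r * g₁ r) = -(2 * k * g₁ r ^ 2) := by
      linear_combination -2 * g₁ r * hode' r hr
    by_contra! hpos
    have := mul_pos hr.1 hpos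
    nlinarith [mul_nonneg hk.le (sq_nonneg (g₁ r))]
  refine eq_zero_of_abs_deriv_le_mul_abs_self_of_eq_zero_right (K := 1) hcg.continuousOn
    (fun r _ => (h₀ r).hasDerivWithinAt) hg (fun r hr => ?_) r hr
  rw [one_mul, Real.norm_eq_abs, Real.norm_eq_abs, ← sq_le_sq]
  have := hanti (left_mem_Icc.2 hR.le) (Ico_subset_Icc_self hr) hr.1
  simpa [hg, hg₁] using this

end RadialODE

/-! ### Measures on the sphere: generating functions and rotation invariance. -/

theorem integrableExpSet_inner_sphere {E : Type*} [NormedAddCommGroup E] [InnerProductSpace ℝ E]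
    [MeasurableSpace E] [BorelSpace E] (μ : Measure (Metric.sphere (0 : E) 1)) [IsFiniteMeasure μ]
    (t : E) : integrableExpSet (fun x : Metric.sphere (0 : E) 1 => inner ℝ (x : E) t) μ = univ := by
  refine eq_univ_of_forall fun r => ?_
  refine integrable_exp_mul_of_mem_Icc (a := -‖t‖) (b := ‖t‖) ?_ (ae_of_all _ fun x => ?_)
  · exact (Continuous.measurable (by fun_prop)).aemeasurable
  · rw [mem_Icc, ← abs_le]
    simpa [mem_sphere_zero_iff_norm.1 x.2] using abs_real_inner_le_norm (x : E) t

section SphereMeasure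

variable {E : Type} [NormedAddCommGroup E] [InnerProductSpace ℝ E] [FiniteDimensional ℝ E]
  [MeasurableSpace E] [BorelSpace E]

/-- The integral inherits `ΔW = W` from the kernel, so Dirichlet uniqueness carries its vanishing
from the sphere to the ball. -/
theorem integral_sphericalKernel_eq_zero_of_norm_le
    (μ : Measure (Metric.sphere (0 : E) 1)) [IsFiniteMeasure μ] {R : ℝ}
    (h : ∀ s : E, ‖s‖ = R →
      ∫ x, sphericalKernel (Module.finrank ℝ E - 1 : ℝ) (s, (x : E)) ∂μ = 0)
    {s : E} (hs : ‖s‖ ≤ R) :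
    ∫ x, sphericalKernel (Module.finrank ℝ E - 1 : ℝ) (s, (x : E)) ∂μ = 0 := by
  have hK : ContDiffOn ℝ 2 (sphericalKernel (E := E) (Module.finrank ℝ E - 1 : ℝ))
      (univ ×ˢ univ) := (contDiff_sphericalKernel _).contDiffOn
  refine eq_zero_of_laplacian_eq_self
    (W := fun s => ∫ x, sphericalKernel (Module.finrank ℝ E - 1 : ℝ) (s, (x : E)) ∂μ)
    ?_ (fun y _ => ?_) h hs
  · rw [← contDiffOn_univ]
    exact contDiffOn_integral_slice μ isOpen_univ continuous_subtype_val 2 hK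
  · rw [laplacian_integral_slice μ isOpen_univ continuous_subtype_val hK (mem_univ y)]
    exact integral_congr_ae (ae_of_all _ fun x =>
      laplacian_sphericalKernel y (mem_sphere_zero_iff_norm.1 x.2))

/-- The sphere is bounded, so each directional generating function is analytic on all of `ℝ`.
Agreement to the right of `0` therefore spreads to the line and then to the complex plane, where the
value at `Complex.I` is the characteristic function. -/
theorem MeasureTheory.Measure.ext_of_mgf_inner_sphere {μ ν : Measure (Metric.sphere (0 : E) 1)}
    [IsProbabilityMeasure μ] [IsProbabilityMeasure ν]
    (h : ∀ t : E, ∀ᶠ r in 𝓝[>] (0 : ℝ),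
      mgf (fun x : Metric.sphere (0 : E) 1 => inner ℝ (x : E) t) μ r =
      mgf (fun x : Metric.sphere (0 : E) 1 => inner ℝ (x : E) t) ν r) : μ = ν := by
  refine (MeasurableEmbedding.subtype_coe Metric.isClosed_sphere.measurableSet).map_injective ?_
  refine Measure.ext_of_charFun (funext fun t => ?_)
  have han (μ : Measure (Metric.sphere (0 : E) 1)) [IsFiniteMeasure μ] :
      AnalyticOnNhd ℝ (mgf (fun x : Metric.sphere (0 : E) 1 => inner ℝ (x : E) t) μ) univ := by
    simpa [integrableExpSet_inner_sphere μ t] using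
      analyticOnNhd_mgf (X := fun x : Metric.sphere (0 : E) 1 => inner ℝ (x : E) t) (μ := μ)
  have hmgf : mgf (fun x : Metric.sphere (0 : E) 1 => inner ℝ (x : E) t) μ =
      mgf (fun x : Metric.sphere (0 : E) 1 => inner ℝ (x : E) t) ν :=
    (han μ).eq_of_frequently_eq (han ν) (z₀ := 0)
      ((h t).frequently.filter_mono (nhdsWithin_mono _ fun r (hr : 0 < r) => hr.ne'))
  have := eqOn_complexMGF_of_mgf hmgf (x := Complex.I)
    (by simp [integrableExpSet_inner_sphere μ t])
  rw [charFun_apply, charFun_apply, integral_map (by fun_prop) (by fun_prop),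
    integral_map (by fun_prop) (by fun_prop)]
  simpa [complexMGF, mul_comm] using this

/-- A probability measure on the sphere is determined by the vanishing, on a single sphere, of the
integral of the spherical kernel. -/
theorem MeasureTheory.Measure.ext_of_integral_sphericalKernel
    {μ ν : Measure (Metric.sphere (0 : E) 1)} [IsProbabilityMeasure μ] [IsProbabilityMeasure ν]
    (hE : 1 < Module.finrank ℝ E) {R : ℝ} (hR : 0 < R)
    (hμ : ∀ s : E, ‖s‖ = R →
      ∫ x, sphericalKernel (Module.finrank ℝ E - 1 : ℝ) (s, (x : E)) ∂μ = 0)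
    (hν : ∀ s : E, ‖s‖ = R →
      ∫ x, sphericalKernel (Module.finrank ℝ E - 1 : ℝ) (s, (x : E)) ∂ν = 0) : μ = ν := by
  set k : ℝ := Module.finrank ℝ E - 1 with hk
  have hk0 : 0 < k := by
    have : (1 : ℝ) < Module.finrank ℝ E := by exact_mod_cast hE
    linarith
  have unit (t : E) (ht : ‖t‖ = 1) {r : ℝ} (hr : r ∈ Icc 0 R) :
      mgf (fun x : Metric.sphere (0 : E) 1 => inner ℝ (x : E) t) μ r =
        mgf (fun x : Metric.sphere (0 : E) 1 => inner ℝ (x : E) t) ν r := by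
    let w : Metric.sphere (0 : E) 1 → ℝ := fun x => inner ℝ (x : E) t
    -- `m μ 0` is the generating function along `t`, and `m μ n` is its `n`-th derivative.
    let m (μ : Measure (Metric.sphere (0 : E) 1)) (n : ℕ) (r : ℝ) : ℝ :=
      ∫ x, w x ^ n * Real.exp (r * w x) ∂μ
    have hm (μ : Measure (Metric.sphere (0 : E) 1)) [IsFiniteMeasure μ] (n : ℕ) (r : ℝ) :
        HasDerivAt (m μ n) (m μ (n + 1) r) r :=
      hasDerivAt_integral_pow_mul_exp_real (by simp [w, integrableExpSet_inner_sphere μ t]) n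
    have hint (μ : Measure (Metric.sphere (0 : E) 1)) [IsFiniteMeasure μ] (n : ℕ) (r : ℝ) :
        Integrable (fun x => w x ^ n * Real.exp (r * w x)) μ :=
      integrable_pow_mul_exp_of_mem_interior_integrableExpSet
        (by simp [w, integrableExpSet_inner_sphere μ t]) n
    have hode (μ : Measure (Metric.sphere (0 : E) 1)) [IsFiniteMeasure μ]
        (hμ : ∀ s : E, ‖s‖ = R → ∫ x, sphericalKernel k (s, (x : E)) ∂μ = 0) (r : ℝ)
        (hr : r ∈ Ioo 0 R) : r ^ 2 * m μ 0 r - r ^ 2 * m μ 2 r - k * r * m μ 1 r = 0 := by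
      have hnr : ‖r • t‖ = r := by rw [norm_smul, ht, mul_one, Real.norm_of_nonneg hr.1.le]
      rw [← integral_sphericalKernel_eq_zero_of_norm_le μ hμ (s := r • t) (hnr.trans_le hr.2.le)]
      have hint₂ : Integrable (fun x => r ^ 2 * (w x ^ 0 * Real.exp (r * w x))
          - r ^ 2 * (w x ^ 2 * Real.exp (r * w x))) μ :=
        ((hint μ 0 r).const_mul _).sub ((hint μ 2 r).const_mul _)
      simp only [m]
      rw [← integral_const_mul, ← integral_const_mul, ← integral_const_mul,
        ← integral_sub ((hint μ 0 r).const_mul _) ((hint μ 2 r).const_mul _),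
        ← integral_sub hint₂ ((hint μ 1 r).const_mul _)]
      refine integral_congr_ae (ae_of_all _ fun x => ?_)
      simp only [sphericalKernel, hnr, real_inner_smul_left, w, real_inner_comm t (x : E)]
      ring
    have hc : Continuous fun r => m μ 2 r - m ν 2 r :=
      continuous_iff_continuousAt.2 fun r => ((hm μ 2 r).sub (hm ν 2 r)).continuousAt
    -- The difference vanishes at `0` because both measures have total mass one.
    have := eq_zero_of_radial_ode (g := fun r => m μ 0 r - m ν 0 r)
      (g₁ := fun r => m μ 1 r - m ν 1 r) (g₂ := fun r => m μ 2 r - m ν 2 r) hk0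
      (fun r => (hm μ 0 r).sub (hm ν 0 r)) (fun r => (hm μ 1 r).sub (hm ν 1 r)) hc
      (fun r hr => by linear_combination hode μ hμ r hr - hode ν hν r hr) (by simp [m]) hr
    simpa [m, mgf, w, sub_eq_zero] using this
  refine Measure.ext_of_mgf_inner_sphere fun t => ?_
  by_cases ht : t = 0
  · exact .of_forall fun r => by simp [ht, mgf]
  have ht0 : 0 < ‖t‖ := norm_pos_iff.2 ht
  -- A general `t` is reduced to a unit vector; the range `r * ‖t‖ ≤ R` suffices, since only small
  -- `r` matter.
  have hscale (μ : Measure (Metric.sphere (0 : E) 1)) (r : ℝ) :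
      mgf (fun x : Metric.sphere (0 : E) 1 => inner ℝ (x : E) t) μ r =
        mgf (fun x : Metric.sphere (0 : E) 1 => inner ℝ (x : E) (‖t‖⁻¹ • t)) μ (r * ‖t‖) := by
    simp only [mgf, real_inner_smul_right]
    congr with x
    field_simp
  filter_upwards [Ioo_mem_nhdsGT (div_pos hR ht0)] with r hr
  rw [hscale, hscale]
  refine unit _ (by rw [norm_smul, norm_inv, norm_norm, inv_mul_cancel₀ ht0.ne']) ⟨?_, ?_⟩
  · exact mul_nonneg hr.1.le ht0.le
  · exact ((lt_div_iff₀ ht0).1 hr.2).le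

open scoped Pointwise in
-- The surface measure of a set is the volume of the cone over it, up to a dimensional factor; an
-- isometry commutes with scaling and preserves volume.
theorem integral_toSphere_comp_linearIsometryEquiv (L : E ≃ₗᵢ[ℝ] E) (f : E → ℝ) :
    ∫ x : Metric.sphere (0 : E) 1, f (L x) ∂(volume : Measure E).toSphere =
      ∫ x : Metric.sphere (0 : E) 1, f x ∂(volume : Measure E).toSphere := by
  let ρ : Metric.sphere (0 : E) 1 ≃ₜ Metric.sphere (0 : E) 1 :=
    L.toHomeomorph.subtype fun x => by simp
  have hρ : MeasurePreserving ρ (volume : Measure E).toSphere (volume : Measure E).toSphere := by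
    refine ⟨ρ.continuous.measurable, Measure.ext fun s hs => ?_⟩
    rw [Measure.map_apply ρ.continuous.measurable hs,
      Measure.toSphere_apply' _ (ρ.continuous.measurable hs), Measure.toSphere_apply' _ hs]
    congr 1
    rw [← L.measurePreserving.measure_preimage_emb L.toHomeomorph.measurableEmbedding
      (Ioo (0 : ℝ) 1 • ((↑) '' s : Set E))]
    congr 1
    ext y
    simp only [Set.mem_smul, mem_preimage]
    constructor
    · rintro ⟨r, hr, _, ⟨x, hx, rfl⟩, rfl⟩
      exact ⟨r, hr, L x, ⟨ρ x, hx, rfl⟩, by simp⟩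
    · rintro ⟨r, hr, _, ⟨x, hx, rfl⟩, hy⟩
      refine ⟨r, hr, ρ.symm x, ⟨ρ.symm x, by simpa using hx, rfl⟩, ?_⟩
      apply L.injective
      rw [← hy, map_smul]
      congr 1
      exact congrArg Subtype.val (ρ.apply_symm_apply x)
  exact hρ.integral_comp ρ.measurableEmbedding fun x => f x

/-- Zonal integrals over the sphere do not depend on the axis. -/
theorem integral_toSphere_inner_eq (f : ℝ → ℝ) {s t : E} (hst : ‖s‖ = ‖t‖) :
    ∫ x : Metric.sphere (0 : E) 1, f (inner ℝ s (x : E)) ∂(volume : Measure E).toSphere =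
      ∫ x : Metric.sphere (0 : E) 1, f (inner ℝ t (x : E)) ∂(volume : Measure E).toSphere := by
  -- This reflection exchanges `s` and `t`, since their norms are equal.
  let L := (ℝ ∙ (s - t))ᗮ.reflection
  rw [← integral_toSphere_comp_linearIsometryEquiv L fun x => f (inner ℝ t x)]
  congr with x
  rw [← Submodule.reflection_sub hst, LinearIsometryEquiv.inner_map_map]

end SphereMeasure

/-! ### The spherical Laplacian and the uniform distribution. -/

section UnitSphere

variable {p : ℕ}

theorem UnitSphere.norm_coe (x : UnitSphere p) : ‖(x : EuclideanSpace ℝ (Fin p))‖ = 1 :=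
  mem_sphere_zero_iff_norm.1 x.2

theorem UnitSphere.coe_ne_zero (x : UnitSphere p) : (x : EuclideanSpace ℝ (Fin p)) ≠ 0 :=
  norm_ne_zero_iff.1 (by simp [x.norm_coe])

theorem radialExtension_of_ne {f : EuclideanSpace ℝ (Fin p) → ℝ} {y : EuclideanSpace ℝ (Fin p)}
    (hy : y ≠ 0) : radialExtension (fun x : UnitSphere p => f x) y = f (‖y‖⁻¹ • y) := by
  simp [radialExtension, hy]

theorem sphericalLaplacian_restrict (f : EuclideanSpace ℝ (Fin p) → ℝ) (x : UnitSphere p) :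
    sphericalLaplacian (fun x : UnitSphere p => f x) x =
      Laplacian.laplacian (fun y : EuclideanSpace ℝ (Fin p) => f (‖y‖⁻¹ • y)) x := by
  refine (InnerProductSpace.laplacian_congr_nhds ?_).self_of_nhds
  filter_upwards [isOpen_ne.mem_nhds x.coe_ne_zero] with y hy using radialExtension_of_ne hy

theorem sphericalLaplacian_const (c : ℝ) (x : UnitSphere p) :
    sphericalLaplacian (fun _ : UnitSphere p => c) x = 0 := by
  rw [sphericalLaplacian_restrict (fun _ => c)]
  simp [InnerProductSpace.laplacian_const]

theorem laplacian_exp_inner_normalize_eq_sphericalKernel (c : ℝ) (t x : UnitSphere p) :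
    Laplacian.laplacian (fun y : EuclideanSpace ℝ (Fin p) =>
      Real.exp (c * inner ℝ (‖y‖⁻¹ • y) (x : EuclideanSpace ℝ (Fin p)))) t =
      sphericalKernel (p - 1 : ℝ)
        (c • (t : EuclideanSpace ℝ (Fin p)), (x : EuclideanSpace ℝ (Fin p))) := by
  rw [laplacian_exp_inner_normalize c t.norm_coe x.norm_coe, sphericalKernel]
  simp only [finrank_euclideanSpace_fin, real_inner_smul_left, norm_smul, t.norm_coe,
    Real.norm_eq_abs, mul_one, sq_abs]
  ring

/-- The exponential is symmetric in the two unit vectors, and at `(c • t, x)` the kernel depends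
only on `c` and `⟪t, x⟫`; so the Laplacian in `x` equals the one in `t`. -/
theorem sphericalLaplacian_expTest (c : ℝ) (t x : UnitSphere p) :
    sphericalLaplacian (expTest c t) x =
      sphericalKernel (p - 1 : ℝ)
        (c • (t : EuclideanSpace ℝ (Fin p)), (x : EuclideanSpace ℝ (Fin p))) := by
  have h := sphericalLaplacian_restrict (fun y => Real.exp (c * inner ℝ y t)) x
  rw [laplacian_exp_inner_normalize_eq_sphericalKernel] at h
  have h' : expTest c t = fun x : UnitSphere p =>
      Real.exp (c * inner ℝ (x : EuclideanSpace ℝ (Fin p)) t) :=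
    funext fun x => by rw [expTest, real_inner_comm]
  rw [h', h, sphericalKernel, sphericalKernel]
  simp only [real_inner_smul_left, norm_smul, UnitSphere.norm_coe,
    real_inner_comm (t : EuclideanSpace ℝ (Fin p)) x]

theorem sphericalLaplacian_integral_exp (μ : Measure (UnitSphere p)) [IsFiniteMeasure μ] (c : ℝ)
    (t : UnitSphere p) :
    sphericalLaplacian (fun s : UnitSphere p => ∫ x : UnitSphere p,
      Real.exp (inner ℝ (c • (s : EuclideanSpace ℝ (Fin p))) (x : EuclideanSpace ℝ (Fin p))) ∂μ) t =
      ∫ x : UnitSphere p, sphericalKernel (p - 1 : ℝ)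
        (c • (t : EuclideanSpace ℝ (Fin p)), (x : EuclideanSpace ℝ (Fin p))) ∂μ := by
  rw [sphericalLaplacian_restrict fun s => ∫ x : UnitSphere p,
    Real.exp (inner ℝ (c • s) (x : EuclideanSpace ℝ (Fin p))) ∂μ]
  simp_rw [real_inner_smul_left _ _ c]
  have hU : IsOpen {y : EuclideanSpace ℝ (Fin p) | y ≠ 0} := isOpen_ne
  rw [laplacian_integral_slice μ hU continuous_subtype_val
    (f := fun z => Real.exp (c * inner ℝ (‖z.1‖⁻¹ • z.1) z.2))
    (fun z hz => (contDiffAt_exp_inner_normalize c hz.1).contDiffWithinAt) t.coe_ne_zero]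
  exact integral_congr_ae (ae_of_all _ fun x =>
    laplacian_exp_inner_normalize_eq_sphericalKernel c t x)

instance isProbabilityMeasure_uniformSphere [NeZero p] :
    IsProbabilityMeasure (uniformSphere p) := by
  have : Nonempty (Fin p) := ⟨0⟩
  refine ⟨?_⟩
  rw [uniformSphere, Measure.smul_apply, smul_eq_mul, ENNReal.inv_mul_cancel]
  · exact Measure.measure_univ_ne_zero.2 (Measure.toSphere_ne_zero _)
  · exact (measure_lt_top (volume : Measure (EuclideanSpace ℝ (Fin p))).toSphere univ).ne

/-- The integral is the spherical Laplacian of the generating function at radius `|c|`, which is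
constant in `t` by rotation invariance. -/
theorem integral_sphericalKernel_uniformSphere [NeZero p] (c : ℝ) (t : UnitSphere p) :
    ∫ x : UnitSphere p, sphericalKernel (p - 1 : ℝ)
      (c • (t : EuclideanSpace ℝ (Fin p)), (x : EuclideanSpace ℝ (Fin p)))
      ∂(uniformSphere p) = 0 := by
  rw [← sphericalLaplacian_integral_exp]
  have h (s : UnitSphere p) : ∫ x : UnitSphere p,
      Real.exp (inner ℝ (c • (s : EuclideanSpace ℝ (Fin p))) (x : EuclideanSpace ℝ (Fin p)))
        ∂(uniformSphere p) = ∫ x : UnitSphere p,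
      Real.exp (inner ℝ (c • (t : EuclideanSpace ℝ (Fin p))) (x : EuclideanSpace ℝ (Fin p)))
        ∂(uniformSphere p) := by
    simp only [uniformSphere, surfaceMeasure, integral_smul_measure]
    congr 1
    exact integral_toSphere_inner_eq Real.exp (by simp [norm_smul])
  simp_rw [h]
  exact sphericalLaplacian_const _ t

theorem eq_uniformSphere_iff (hp : 2 ≤ p) {c : ℝ} (hc : 0 < c) (μ : Measure (UnitSphere p))
    [IsProbabilityMeasure μ] :
    (∀ t : UnitSphere p, ∫ x : UnitSphere p, sphericalKernel (p - 1 : ℝ)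
      (c • (t : EuclideanSpace ℝ (Fin p)), (x : EuclideanSpace ℝ (Fin p))) ∂μ = 0) ↔
      μ = uniformSphere p := by
  have : NeZero p := ⟨by omega⟩
  refine ⟨fun h => ?_, fun h t => h ▸ integral_sphericalKernel_uniformSphere c t⟩
  have key (ν : Measure (UnitSphere p)) (hν : ∀ t : UnitSphere p,
      ∫ x : UnitSphere p, sphericalKernel (p - 1 : ℝ)
        (c • (t : EuclideanSpace ℝ (Fin p)), (x : EuclideanSpace ℝ (Fin p))) ∂ν = 0)
      (s : EuclideanSpace ℝ (Fin p)) (hs : ‖s‖ = c) :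
      ∫ x : UnitSphere p, sphericalKernel
        (Module.finrank ℝ (EuclideanSpace ℝ (Fin p)) - 1 : ℝ) (s, (x : EuclideanSpace ℝ (Fin p)))
        ∂ν = 0 := by
    have hs' : ‖c⁻¹ • s‖ = 1 := by
      rw [norm_smul, hs, Real.norm_of_nonneg (inv_nonneg.2 hc.le), inv_mul_cancel₀ hc.ne']
    simpa [smul_smul, hc.ne'] using hν ⟨c⁻¹ • s, mem_sphere_zero_iff_norm.2 hs'⟩
  exact Measure.ext_of_integral_sphericalKernel (by rw [finrank_euclideanSpace_fin]; omega) hc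
    (key μ h) (key _ (integral_sphericalKernel_uniformSphere c))

theorem continuous_sphericalKernel_coe (k : ℝ) (s : EuclideanSpace ℝ (Fin p)) :
    Continuous fun x : UnitSphere p => sphericalKernel k (s, (x : EuclideanSpace ℝ (Fin p))) :=
  (contDiff_sphericalKernel (n := 0) k).continuous.comp (by fun_prop)

end UnitSphere

/-! ### Transfer to the random vector and the main theorem. -/

theorem sphereMgf_eq_integral_map {Ω : Type*} [MeasurableSpace Ω] {p : ℕ} (P : Measure Ω)
    {X : Ω → UnitSphere p} (hX : Measurable X) (s : EuclideanSpace ℝ (Fin p)) :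
    sphereMgf P X s =
      ∫ x : UnitSphere p, Real.exp (inner ℝ s (x : EuclideanSpace ℝ (Fin p))) ∂(P.map X) := by
  rw [integral_map hX.aemeasurable (Continuous.aestronglyMeasurable (by fun_prop))]
  rfl

theorem contDiff_sphereMgf {Ω : Type*} [MeasurableSpace Ω] {p : ℕ} (P : Measure Ω)
    [IsFiniteMeasure P] {X : Ω → UnitSphere p} (hX : Measurable X) (n : ℕ) :
    ContDiff ℝ n (sphereMgf P X) := by
  rw [funext (sphereMgf_eq_integral_map P hX), ← contDiffOn_univ]
  exact contDiffOn_integral_slice (P.map X) isOpen_univ continuous_subtype_val n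
    (f := fun z => Real.exp (inner ℝ z.1 z.2)) (contDiff_fst.inner ℝ contDiff_snd).exp.contDiffOn

theorem proposition1 {Ω : Type*} [MeasurableSpace Ω] (P : Measure Ω) [IsProbabilityMeasure P]
    (p : ℕ) (hp : 2 ≤ p) (lam : ℝ) (hlam : 0 < lam)
    (X : Ω → UnitSphere p) (hX : Measurable X) (hac : P.map X ≪ surfaceMeasure p) :
    -- the expectation and the Laplace-Beltrami operator below are applied to functions for which
    -- they are defined
    (∀ t : UnitSphere p, Integrable (fun ω => sphericalLaplacian (expTest lam t) (X ω)) P) ∧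
    ContDiff ℝ 2 (sphereMgf P X) ∧
    -- `E[Δ exp(lam tᵀX)] = Δ_t M_X(lam t)`
    (∀ t : UnitSphere p,
      ∫ ω, sphericalLaplacian (expTest lam t) (X ω) ∂P =
        sphericalLaplacian
          (fun s : UnitSphere p => sphereMgf P X (lam • (s : EuclideanSpace ℝ (Fin p)))) t) ∧
    -- the characterization
    (((∀ t : UnitSphere p, ∫ ω, sphericalLaplacian (expTest lam t) (X ω) ∂P = 0) ∧
        sphereMgf P X 0 = 1) ↔
      P.map X = uniformSphere p) := by
  have : IsProbabilityMeasure (P.map X) := Measure.isProbabilityMeasure_map hX.aemeasurable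
  have hcont (t : UnitSphere p) : Continuous (sphericalLaplacian (expTest lam t)) := by
    rw [funext (sphericalLaplacian_expTest lam t)]
    exact continuous_sphericalKernel_coe _ _
  have hint (t : UnitSphere p) : ∫ ω, sphericalLaplacian (expTest lam t) (X ω) ∂P =
      ∫ x : UnitSphere p, sphericalKernel (p - 1 : ℝ)
        (lam • (t : EuclideanSpace ℝ (Fin p)), (x : EuclideanSpace ℝ (Fin p))) ∂(P.map X) := by
    rw [← integral_map hX.aemeasurable (hcont t).aestronglyMeasurable]
    simp_rw [sphericalLaplacian_expTest]
  refine ⟨fun t => ?_, contDiff_sphereMgf P hX 2, fun t => ?_, ?_⟩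
  · obtain ⟨C, hC⟩ := isCompact_univ.exists_bound_of_continuousOn (hcont t).continuousOn
    exact .of_bound ((hcont t).measurable.comp hX).aestronglyMeasurable C
      (ae_of_all _ fun ω => hC (X ω) (mem_univ _))
  · simp_rw [hint, sphereMgf_eq_integral_map P hX, sphericalLaplacian_integral_exp]
  -- The normalization is automatic for a probability measure, so only the vanishing condition
  -- carries content.
  · have h0 : sphereMgf P X 0 = 1 := by simp [sphereMgf]
    simp_rw [hint, eq_uniformSphere_iff hp hlam, h0, and_true]
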